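/- Let $X$ be the Cantor set, let $U,V\subseteq X$ be open sets such that $X_U=X\setminus U$ and $X_V=X\setminus V$ are finite, nonempty and disjoint, and let $h:U\to V$ be a homeomorphism that is minimal, i.e. for every $x\in X$ the orbit $\{h^n(x): n\in\mathbb Z,\ h^n(x)\text{ is defined}\}$ is dense in $X$. A *Kakutani–Rokhlin partition* for $(X,h)$ is a partition $\{E(k,j): 1\le k\le K,\ 1\le j\le J(k)\}$ of $X$ into nonempty clopen sets, with positive integers $K, J(1),\dots,J(K)$, such that $X_U\subseteq\bigcup_k E(k,J(k))$, $X_V\subseteq\bigcup_k E(k,1)$, $h(E(k,j))=E(k,j+1)$ for $1\le j<J(k)$, and $\bigcup_k h(E(k,J(k))\setminus X_U)\cup X_V=\bigcup_k E(k,1)$. Let $\mathcal P_n=\{E(n,k,j): 1\le k\le K_n,\ 1\le j\le J(n,k)\}$, $n\ge 0$, be a sequence of Kakutani–Rokhlin partitions for $(X,h)$ such that $\mathcal P_0=\{X\}$ (so $K_0=J(0,1)=1$ and $E(0,1,1)=X$), the sets $\bigcup_k E(n,k,1)$ decrease with $n$ and have intersection $X_V$, each $\mathcal P_{n+1}$ is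 finer than $\mathcal P_n$, and $\bigcup_n\mathcal P_n$ generates the topology of $X$. Let $B$ be the ordered Bratteli diagram with vertex sets $V_n=\{(n,k): 1\le k\le K_n\}$ for $n\ge 0$ and with edge sets $E_n$, $n\ge 1$, consisting of all $(n,m,k,j')$ with $1\le m\le K_{n-1}$, $1\le k\le K_n$, $j'\ge 0$, $j'+J(n-1,m)\le J(n,k)$ and $$E(n,k,j'+j)\subseteq E(n-1,m,j)\qquad\text{for all } 1\le j\le J(n-1,m);$$ such an edge has source $(n-1,m)$ and range $(n,k)$, and edges with the same range are ordered by $j'$ (edges with different ranges are not comparable). Let $X_B$ be the space of infinite paths $\xi=\xi_1\xi_2\cdots$ in $B$, where $\xi_n\in E_n$ and the range of $\xi_n$ is the source of $\xi_{n+1}$, with the topology induced from the product of the discrete spaces $E_n$. Let $X_B^{\max}$ (resp. $X_B^{\min}$) be the set of paths all of whose edges are maximal (resp. minimal) among the edges with the same range, and let $\lambda: X_B\setminus X_B^{\max}\to X_B\setminus X_B^{\min}$ be the Vershik map, which is a homeomorphism: if $\xi_1,\dots,\xi_{n-1}$ are maximal and $\xi_n$ is not, then $\lambda(\xi)=g_1\cdots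 g_n\xi_{n+1}\xi_{n+2}\cdots$, where $g_n$ is the successor of $\xi_n$ and $g_1\cdots g_{n-1}$ is the path of minimal edges from the root to the source of $g_n$. For a homeomorphism $f:W\to Z$ between open subsets of a space $Y$, let $(Y,f)$ be the partial action of $\mathbb Z$ on $Y$ given by the iterates $f^n$, $n\in\mathbb Z$, on the sets where they are defined. Then the partial actions $(X,h)$ and $(X_B,\lambda)$ are isomorphic: there is a homeomorphism $\phi:X\to X_B$ such that, for every $n\in\mathbb Z$, $\phi$ maps the domain of $h^n$ onto the domain of $\lambda^n$ and $\phi\circ h^n=\lambda^n\circ\phi$ there. Moreover $\phi(X_U)=X_B^{\max}$ and $\phi(X_V)=X_B^{\min}$. -/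

import Mathlib

/-- A partial action of an (additively written) group `G` on a topological space `Ω`: open sets
`dom t` and homeomorphisms `act t : dom (-t) → dom t`. -/
structure PartialAction (G : Type*) [AddGroup G] (Ω : Type*) [TopologicalSpace Ω] where
  dom : G → Set Ω
  act : G → OpenPartialHomeomorph Ω Ω
  act_source : ∀ t, (act t).source = dom (-t)
  act_target : ∀ t, (act t).target = dom t
  dom_zero : dom 0 = Set.univ
  act_zero : ∀ x, act 0 x = x
  image_inter : ∀ s t, act t '' (dom (-t) ∩ dom s) = dom t ∩ dom (t + s)
  act_act : ∀ s t, ∀ x ∈ dom (-s) ∩ dom (-s + -t), act t (act s x) = act (t + s) x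

namespace PartialAction

/-- A morphism of partial actions: a continuous map sending `dom t` into `dom t` and
intertwining the partial homeomorphisms. -/
def IsMorphism {G Ω Ω' : Type*} [AddGroup G] [TopologicalSpace Ω] [TopologicalSpace Ω']
    (α : PartialAction G Ω) (β : PartialAction G Ω') (φ : Ω → Ω') : Prop :=
  Continuous φ ∧ (∀ t, Set.MapsTo φ (α.dom t) (β.dom t)) ∧
    ∀ t, ∀ x ∈ α.dom (-t), β.act t (φ x) = φ (α.act t x)

/-- An isomorphism of partial actions: a bijection that is a morphism together with its inverse. -/
def IsIsomorphism {G Ω Ω' : Type*} [AddGroup G] [TopologicalSpace Ω] [TopologicalSpace Ω']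
    (α : PartialAction G Ω) (β : PartialAction G Ω') (φ : Ω ≃ Ω') : Prop :=
  IsMorphism α β φ ∧ IsMorphism β α φ.symm

/-- The orbit of a point under a partial action. -/
def orbit {G Ω : Type*} [AddGroup G] [TopologicalSpace Ω] (α : PartialAction G Ω) (x : Ω) :
    Set Ω :=
  {y | ∃ t, x ∈ α.dom (-t) ∧ α.act t x = y}

end PartialAction

namespace OpenPartialHomeomorph

variable {X : Type*} [TopologicalSpace X]

/-- The iterates `h^n`, `n ∈ ℕ`, on their natural domains. -/
def partialPow (h : OpenPartialHomeomorph X X) : ℕ → OpenPartialHomeomorph X X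
  | 0 => OpenPartialHomeomorph.refl X
  | n + 1 => (partialPow h n).trans h

/-- The iterates `h^n`, `n ∈ ℤ`, on their natural domains. -/
def partialZPow (h : OpenPartialHomeomorph X X) : ℤ → OpenPartialHomeomorph X X
  | Int.ofNat n => partialPow h n
  | Int.negSucc n => (partialPow h (n + 1)).symm

/-- `h^n x` is defined and equal to `y`. -/
def ZPowRel (h : OpenPartialHomeomorph X X) (n : ℤ) (x y : X) : Prop :=
  x ∈ (partialZPow h n).source ∧ partialZPow h n x = y

theorem partialPow_add (h : OpenPartialHomeomorph X X) (m n : ℕ) :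
    partialPow h (m + n) = (partialPow h m).trans (partialPow h n) := by
  induction n with
  | zero => simp [partialPow]
  | succ n ih => rw [← add_assoc, partialPow, ih, partialPow, trans_assoc]

theorem partialZPow_neg (h : OpenPartialHomeomorph X X) (n : ℤ) :
    partialZPow h (-n) = (partialZPow h n).symm := by
  match n with
  | Int.ofNat 0 => rfl
  | Int.ofNat (n + 1) => rfl
  | Int.negSucc n => exact (symm_symm _).symm

theorem zPowRel_neg (h : OpenPartialHomeomorph X X) (n : ℤ) (x y : X) :
    ZPowRel h (-n) x y ↔ ZPowRel h n y x := by
  unfold ZPowRel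
  rw [partialZPow_neg]
  constructor
  · rintro ⟨hx, rfl⟩
    exact ⟨map_target _ hx, right_inv _ hx⟩
  · rintro ⟨hy, rfl⟩
    exact ⟨map_source _ hy, left_inv _ hy⟩

theorem zPowRel_natCast_add (h : OpenPartialHomeomorph X X) (m n : ℕ) (x z : X) :
    ZPowRel h (m + n : ℕ) x z ↔ ∃ y, ZPowRel h m x y ∧ ZPowRel h n y z := by
  have key : ∀ k : ℕ, partialZPow h (k : ℤ) = partialPow h k := fun _ => rfl
  unfold ZPowRel
  rw [key, key, key, partialPow_add]
  simp only [trans_source, Set.mem_inter_iff, Set.mem_preimage, coe_trans, Function.comp]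
  grind

theorem ZPowRel.unique {h : OpenPartialHomeomorph X X} {n : ℤ} {x y z : X}
    (hy : ZPowRel h n x y) (hz : ZPowRel h n x z) : y = z :=
  hy.2.symm.trans hz.2

theorem zPowRel_zero (h : OpenPartialHomeomorph X X) (x y : X) :
    ZPowRel h 0 x y ↔ x = y :=
  ⟨fun hx => hx.2, fun hx => ⟨trivial, hx⟩⟩

theorem ZPowRel.add_nat_iff {h : OpenPartialHomeomorph X X} {n : ℤ} {x y : X}
    (hxy : ZPowRel h n x y) (m : ℕ) (z : X) :
    ZPowRel h (n + m) x z ↔ ZPowRel h m y z := by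
  obtain ⟨k, rfl | rfl⟩ := n.eq_nat_or_neg
  · rw [← Nat.cast_add, zPowRel_natCast_add]
    exact ⟨fun ⟨w, hw, hz⟩ => hxy.unique hw ▸ hz, fun hz => ⟨y, hxy, hz⟩⟩
  · rw [zPowRel_neg] at hxy
    rcases le_total k m with hkm | hkm
    · obtain ⟨l, rfl⟩ := Nat.exists_eq_add_of_le hkm
      rw [zPowRel_natCast_add, show (-(k : ℤ) + (k + l : ℕ)) = (l : ℤ) by push_cast; ring]
      exact ⟨fun hz => ⟨x, hxy, hz⟩, fun ⟨w, hw, hz⟩ => hxy.unique hw ▸ hz⟩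
    · obtain ⟨l, rfl⟩ := Nat.exists_eq_add_of_le hkm
      rw [show (-((m + l : ℕ) : ℤ) + m) = -(l : ℤ) by push_cast; ring, zPowRel_neg]
      obtain ⟨w, hw, hwx⟩ := (zPowRel_natCast_add h m l y x).1 hxy
      refine ⟨fun hz => ?_, fun hz => hz.unique hw ▸ hwx⟩
      rw [← zPowRel_neg] at hz hwx
      exact hwx.unique hz ▸ hw

theorem ZPowRel.add_iff {h : OpenPartialHomeomorph X X} {n : ℤ} {x y : X}
    (hxy : ZPowRel h n x y) (m : ℤ) (z : X) :
    ZPowRel h (n + m) x z ↔ ZPowRel h m y z := by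
  obtain ⟨k, rfl | rfl⟩ := m.eq_nat_or_neg
  · exact hxy.add_nat_iff k z
  refine ⟨fun hz => ?_, fun hz => ?_⟩
  · exact (zPowRel_neg h k y z).2 ((hz.add_nat_iff k y).1 (by simpa using hxy))
  rw [zPowRel_neg] at hz
  have inj : ∀ (l : ℤ) (u v w : X), ZPowRel h l u w → ZPowRel h l v w → u = v :=
    fun l u v w hu hv =>
      ((zPowRel_neg h l w u).2 hu).unique ((zPowRel_neg h l w v).2 hv)
  obtain ⟨a, rfl | rfl⟩ := n.eq_nat_or_neg
  · rcases le_total k a with hka | hka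
    · obtain ⟨l, rfl⟩ := Nat.exists_eq_add_of_le' hka
      obtain ⟨w, hw, hwy⟩ := (zPowRel_natCast_add h l k x y).1 hxy
      rw [show ((l + k : ℕ) : ℤ) + -(k : ℤ) = l by push_cast; ring]
      exact inj k z w y hz hwy ▸ hw
    · obtain ⟨l, rfl⟩ := Nat.exists_eq_add_of_le' hka
      obtain ⟨w, hw, hwy⟩ := (zPowRel_natCast_add h l a z y).1 hz
      rw [show (a : ℤ) + -((l + a : ℕ) : ℤ) = -(l : ℤ) by push_cast; ring, zPowRel_neg]
      exact inj a x w y hxy hwy ▸ hw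
  · rw [zPowRel_neg] at hxy
    rw [show -(a : ℤ) + -(k : ℤ) = -((k + a : ℕ) : ℤ) by push_cast; ring, zPowRel_neg]
    exact (zPowRel_natCast_add h k a z x).2 ⟨y, hz, hxy⟩

theorem mem_target_partialZPow_iff (h : OpenPartialHomeomorph X X) (n : ℤ) (y : X) :
    y ∈ (partialZPow h n).target ↔ ∃ x, ZPowRel h n x y :=
  ⟨fun hy => ⟨_, map_target _ hy, right_inv _ hy⟩, fun ⟨_, hx, hxy⟩ => hxy ▸ map_source _ hx⟩

/-- The partial action of `ℤ` generated by a homeomorphism `h : U → V` between open sets: `h^n` on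
the set of points where `h^n` is defined. -/
def toPartialAction (h : OpenPartialHomeomorph X X) : PartialAction ℤ X where
  dom n := (partialZPow h n).target
  act n := partialZPow h n
  act_source t := by rw [partialZPow_neg]; rfl
  act_target _ := rfl
  dom_zero := rfl
  act_zero _ := rfl
  image_inter s t := by
    ext z
    simp only [Set.mem_image, Set.mem_inter_iff, mem_target_partialZPow_iff, zPowRel_neg]
    constructor
    · rintro ⟨y, ⟨⟨z', hz'⟩, x, hx⟩, rfl⟩
      have hz : ZPowRel h t y (partialZPow h t y) := ⟨hz'.1, rfl⟩
      exact ⟨⟨y, hz⟩, x, by rw [add_comm]; exact (hx.add_iff t _).2 hz⟩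
    · rintro ⟨⟨y, hy⟩, x, hx⟩
      refine ⟨y, ⟨⟨z, hy⟩, x, ?_⟩, hy.2⟩
      have := (hx.add_iff (-t) y).2 ((zPowRel_neg h t z y).2 hy)
      simpa using this
  act_act s t x hx := by
    obtain ⟨hs, hst⟩ := hx
    rw [← neg_add, mem_target_partialZPow_iff] at hst
    rw [mem_target_partialZPow_iff] at hs
    obtain ⟨y, hy⟩ := hs
    obtain ⟨z, hz⟩ := hst
    rw [zPowRel_neg] at hy hz
    rw [add_comm t s, hz.2, hy.2]
    exact ((hy.add_iff t z).1 hz).2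

/-- `h` is minimal if every orbit of the partial action it generates is dense. -/
def IsMinimal (h : OpenPartialHomeomorph X X) : Prop :=
  ∀ x, Dense (h.toPartialAction.orbit x)

end OpenPartialHomeomorph

/-- An ordered Bratteli diagram. `V n` is the set of vertices at level `n`, and `E n` is the set of
edges from level `n` to level `n + 1`. Edges are comparable exactly when they have the same range. -/
structure OrderedBratteliDiagram where
  V : ℕ → Type
  E : ℕ → Type
  src : ∀ n, E n → V n
  rng : ∀ n, E n → V (n + 1)
  finite_V : ∀ n, Finite (V n)
  nonempty_V : ∀ n, Nonempty (V n)
  card_root : Nat.card (V 0) = 1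
  finite_E : ∀ n, Finite (E n)
  nonempty_E : ∀ n, Nonempty (E n)
  src_surjective : ∀ n, Function.Surjective (src n)
  rng_surjective : ∀ n, Function.Surjective (rng n)
  order : ∀ n, PartialOrder (E n)
  comparable_iff : ∀ n (e e' : E n), (e ≤ e' ∨ e' ≤ e) ↔ rng n e = rng n e'

namespace OrderedBratteliDiagram

instance (B : OrderedBratteliDiagram) (n : ℕ) : PartialOrder (B.E n) := B.order n

instance (B : OrderedBratteliDiagram) (n : ℕ) : Finite (B.E n) := B.finite_E n

instance (B : OrderedBratteliDiagram) (n : ℕ) : Nonempty (B.E n) := B.nonempty_E n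

/-- The infinite path space `X_B`. -/
def PathSpace (B : OrderedBratteliDiagram) : Type :=
  {ξ : ∀ n, B.E n // ∀ n, B.rng n (ξ n) = B.src (n + 1) (ξ (n + 1))}

/-- The subspace topology of the product of the discrete spaces `E n`. -/
instance (B : OrderedBratteliDiagram) : TopologicalSpace B.PathSpace :=
  TopologicalSpace.induced (fun ξ => ξ.1) (@Pi.topologicalSpace ℕ B.E fun _ => ⊥)

/-- The set `X_B^max` of paths consisting of maximal edges. -/
def maxPaths (B : OrderedBratteliDiagram) : Set B.PathSpace := {ξ | ∀ n, IsMax (ξ.1 n)}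

/-- The set `X_B^min` of paths consisting of minimal edges. -/
def minPaths (B : OrderedBratteliDiagram) : Set B.PathSpace := {ξ | ∀ n, IsMin (ξ.1 n)}

/-- `η = λ(ξ)` for the Vershik map `λ`: for some `n`, the edges of `ξ` before level `n` are maximal,
the edge of `ξ` at level `n` is not maximal and has the edge of `η` as its successor, the edges of
`η` before level `n` are minimal, and `ξ` and `η` agree after level `n`. -/
def IsVershikImage (B : OrderedBratteliDiagram) (ξ η : B.PathSpace) : Prop :=
  ∃ n, (∀ i < n, IsMax (ξ.1 i)) ∧ ¬ IsMax (ξ.1 n) ∧ ξ.1 n ⋖ η.1 n ∧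
    (∀ i < n, IsMin (η.1 i)) ∧ ∀ i > n, η.1 i = ξ.1 i

/-- The diagram with all orders reversed (used for the inverse of the Vershik map). -/
def dual (B : OrderedBratteliDiagram) : OrderedBratteliDiagram where
  V := B.V
  E n := (B.E n)ᵒᵈ
  src := B.src
  rng := B.rng
  finite_V := B.finite_V
  nonempty_V := B.nonempty_V
  card_root := B.card_root
  finite_E := B.finite_E
  nonempty_E := B.nonempty_E
  src_surjective := B.src_surjective
  rng_surjective := B.rng_surjective
  order _ := inferInstance
  comparable_iff n e e' := by
    rw [or_comm]
    exact B.comparable_iff n e e'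

theorem isVershikImage_dual (B : OrderedBratteliDiagram) (ξ η : B.PathSpace) :
    IsVershikImage B.dual η ξ ↔ IsVershikImage B ξ η := by
  constructor
  · rintro ⟨n, h1, h2, h3, h4, h5⟩
    have h3' : ξ.1 n ⋖ η.1 n := (@toDual_covBy_toDual_iff (B.E n) _ _ _).1 h3
    exact ⟨n, fun i hi => h4 i hi, fun h => h.not_lt h3'.1, h3', fun i hi => h1 i hi,
      fun i hi => (h5 i hi).symm⟩
  · rintro ⟨n, h1, h2, h3, h4, h5⟩
    have h3' : @CovBy (B.dual.E n) _ (η.1 n) (ξ.1 n) :=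
      (@toDual_covBy_toDual_iff (B.E n) _ _ _).2 h3
    exact ⟨n, fun i hi => h4 i hi, fun h => h.not_lt h3'.1, h3', fun i hi => h1 i hi,
      fun i hi => (h5 i hi).symm⟩

theorem rng_eq_of_le (B : OrderedBratteliDiagram) {n : ℕ} {e e' : B.E n} (h : e ≤ e') :
    B.rng n e = B.rng n e' :=
  (B.comparable_iff n e e').1 (Or.inl h)

theorem eq_of_isMin (B : OrderedBratteliDiagram) {n : ℕ} {e e' : B.E n} (he : IsMin e)
    (he' : IsMin e') (h : B.rng n e = B.rng n e') : e = e' := by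
  rcases (B.comparable_iff n e e').2 h with hle | hle
  · exact he'.eq_of_ge hle |>.symm ▸ rfl
  · exact (he.eq_of_le hle).symm ▸ rfl

theorem exists_isMin (B : OrderedBratteliDiagram) (n : ℕ) (v : B.V (n + 1)) :
    ∃ e : B.E n, IsMin e ∧ B.rng n e = v := by
  obtain ⟨e, rfl⟩ := B.rng_surjective n v
  obtain ⟨m, hm, hmin⟩ := (Set.toFinite (Set.univ : Set (B.E n))).exists_le_minimal
    (Set.mem_univ e)
  exact ⟨m, fun b hb => hmin.2 trivial hb, B.rng_eq_of_le hm⟩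

/-- Every vertex is the end of a finite path of minimal edges that starts at the root. -/
theorem exists_minPath (B : OrderedBratteliDiagram) (n : ℕ) (v : B.V n) :
    ∃ η : ∀ i, B.E i, (∀ i < n, IsMin (η i)) ∧
      ∀ e : B.E n, B.src n e = v →
        ∀ i < n, B.rng i (η i) = B.src (i + 1) (Function.update η n e (i + 1)) := by
  induction n with
  | zero => exact ⟨fun i => Classical.arbitrary _, by simp, by simp⟩
  | succ n ih =>
    obtain ⟨g, hg, rfl⟩ := B.exists_isMin n v
    obtain ⟨η, h1, h2⟩ := ih (B.src n g)
    refine ⟨Function.update η n g, fun i hi => ?_, fun e he i hi => ?_⟩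
    · rcases Nat.lt_succ_iff_lt_or_eq.1 hi with h | rfl
      · rw [Function.update_of_ne h.ne]
        exact h1 i h
      · simpa using hg
    · rcases Nat.lt_succ_iff_lt_or_eq.1 hi with h | rfl
      · rw [Function.update_of_ne h.ne, Function.update_of_ne (by omega)]
        exact h2 g rfl i h
      · simp [he]

theorem exists_covBy (B : OrderedBratteliDiagram) {n : ℕ} {e : B.E n} (he : ¬ IsMax e) :
    ∃ g, e ⋖ g := by
  obtain ⟨b, hb⟩ := not_isMax_iff.1 he
  obtain ⟨m, hm, hmin⟩ := (Set.toFinite {b : B.E n | e < b}).exists_le_minimal hb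
  exact ⟨m, hmin.1, fun c hc hcm => hcm.not_ge (hmin.2 hc hcm.le)⟩

theorem eq_of_covBy (B : OrderedBratteliDiagram) {n : ℕ} {e g g' : B.E n} (h : e ⋖ g)
    (h' : e ⋖ g') : g = g' := by
  have : B.rng n g = B.rng n g' := (B.rng_eq_of_le h.le).symm.trans (B.rng_eq_of_le h'.le)
  rcases (B.comparable_iff n g g').2 this with hle | hle
  · exact hle.eq_of_not_lt fun hlt => h'.2 h.1 hlt
  · exact (hle.eq_of_not_lt fun hlt => h.2 h'.1 hlt).symm

theorem exists_isVershikImage (B : OrderedBratteliDiagram) {ξ : B.PathSpace}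
    (hξ : ξ ∉ B.maxPaths) : ∃ η, B.IsVershikImage ξ η := by
  classical
  have hex : ∃ n, ¬ IsMax (ξ.1 n) := by simpa [maxPaths] using hξ
  let n := Nat.find hex
  have hn : ¬ IsMax (ξ.1 n) := Nat.find_spec hex
  have hlt : ∀ i < n, IsMax (ξ.1 i) := fun i hi => not_not.1 (Nat.find_min hex hi)
  obtain ⟨g, hg⟩ := B.exists_covBy hn
  obtain ⟨η, h1, h2⟩ := B.exists_minPath n (B.src n g)
  let ζ : ∀ i, B.E i := fun i => if i ≤ n then Function.update η n g i else ξ.1 i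
  have ζlt : ∀ i < n, ζ i = η i := fun i hi => by
    simp only [ζ, hi.le, if_true]
    exact Function.update_of_ne hi.ne _ _
  have ζn : ζ n = g := by simp [ζ]
  have ζgt : ∀ i > n, ζ i = ξ.1 i := fun i hi => by simp [ζ, Nat.not_le.2 hi]
  refine ⟨⟨ζ, fun i => ?_⟩, n, hlt, hn, ζn ▸ hg, fun i hi => by
    show IsMin (ζ i)
    rw [ζlt i hi]
    exact h1 i hi, ζgt⟩
  rcases lt_trichotomy i n with hi | hi | hi
  · rw [ζlt i hi, h2 g rfl i hi]
    simp [ζ, Nat.succ_le_of_lt hi]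
  · subst hi
    rw [ζn, ζgt _ (Nat.lt_succ_self _), ← ξ.2, B.rng_eq_of_le hg.le]
  · rw [ζgt i hi, ζgt (i + 1) (by omega), ξ.2]

theorem IsVershikImage.unique {B : OrderedBratteliDiagram} {ξ η η' : B.PathSpace}
    (h : B.IsVershikImage ξ η) (h' : B.IsVershikImage ξ η') : η = η' := by
  obtain ⟨n, h1, h2, h3, h4, h5⟩ := h
  obtain ⟨m, h1', h2', h3', h4', h5'⟩ := h'
  obtain rfl : n = m := by
    rcases lt_trichotomy n m with hlt | rfl | hlt
    · exact absurd (h1' n hlt) h2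
    · rfl
    · exact absurd (h1 m hlt) h2'
  have key : ∀ k i, i + k = n → η.1 i = η'.1 i := by
    intro k
    induction k with
    | zero =>
      rintro i rfl
      exact B.eq_of_covBy h3 h3'
    | succ k ih =>
      intro i hi
      refine B.eq_of_isMin (h4 i (by omega)) (h4' i (by omega)) ?_
      rw [η.2, η'.2, ih (i + 1) (by omega)]
  refine Subtype.ext (funext fun i => ?_)
  rcases le_or_gt i n with hi | hi
  · exact key (n - i) i (by omega)
  · rw [h5 i hi, h5' i hi]

theorem IsVershikImage.notMem_maxPaths {B : OrderedBratteliDiagram} {ξ η : B.PathSpace}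
    (h : B.IsVershikImage ξ η) : ξ ∉ B.maxPaths := by
  obtain ⟨n, -, h2, -⟩ := h
  exact fun hmax => h2 (hmax n)

theorem IsVershikImage.notMem_minPaths {B : OrderedBratteliDiagram} {ξ η : B.PathSpace}
    (h : B.IsVershikImage ξ η) : η ∉ B.minPaths :=
  IsVershikImage.notMem_maxPaths (B := B.dual) ((B.isVershikImage_dual ξ η).2 h)

open Classical in
/-- The Vershik map, extended by the identity to the set of maximal paths. -/
noncomputable def vershikFun (B : OrderedBratteliDiagram) (ξ : B.PathSpace) : B.PathSpace :=
  if h : ∃ η, B.IsVershikImage ξ η then h.choose else ξ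

theorem isVershikImage_vershikFun (B : OrderedBratteliDiagram) {ξ : B.PathSpace}
    (hξ : ξ ∉ B.maxPaths) : B.IsVershikImage ξ (B.vershikFun ξ) := by
  have h := B.exists_isVershikImage hξ
  rw [vershikFun, dif_pos h]
  exact h.choose_spec

theorem isOpen_agree (B : OrderedBratteliDiagram) (ξ : B.PathSpace) (n : ℕ) :
    IsOpen {ξ' : B.PathSpace | ∀ i ≤ n, ξ'.1 i = ξ.1 i} := by
  let _ : ∀ i, TopologicalSpace (B.E i) := fun _ => ⊥
  have : ∀ i, DiscreteTopology (B.E i) := fun _ => ⟨rfl⟩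
  refine ⟨{f | ∀ i ≤ n, f i = ξ.1 i}, ?_, rfl⟩
  have : {f : ∀ i, B.E i | ∀ i ≤ n, f i = ξ.1 i} =
      ⋂ i ∈ Set.Iic n, (fun f : ∀ i, B.E i => f i) ⁻¹' {ξ.1 i} := by
    ext f; simp
  rw [this]
  exact (Set.finite_Iic n).isOpen_biInter fun i _ =>
    (isOpen_discrete _).preimage (continuous_apply i)

theorem isOpen_compl_maxPaths (B : OrderedBratteliDiagram) : IsOpen B.maxPathsᶜ := by
  rw [isOpen_iff_forall_mem_open]
  intro ξ hξ
  obtain ⟨n, hn⟩ : ∃ n, ¬ IsMax (ξ.1 n) := by simpa [maxPaths] using hξ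
  refine ⟨_, fun ξ' hξ' hmax => hn ?_, B.isOpen_agree ξ n, fun _ _ => rfl⟩
  rw [← hξ' n le_rfl]
  exact hmax n

theorem continuousOn_vershikFun (B : OrderedBratteliDiagram) :
    ContinuousOn B.vershikFun B.maxPathsᶜ := by
  let _ : ∀ i, TopologicalSpace (B.E i) := fun _ => ⊥
  have : ∀ i, DiscreteTopology (B.E i) := fun _ => ⟨rfl⟩
  rw [B.isOpen_compl_maxPaths.continuousOn_iff]
  intro ξ hξ
  have hind : Topology.IsInducing (fun ξ : B.PathSpace => (ξ.1 : ∀ i, B.E i)) := ⟨rfl⟩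
  rw [hind.continuousAt_iff, continuousAt_pi]
  intro i
  rw [ContinuousAt, nhds_discrete (B.E i), Filter.tendsto_pure]
  have hη := B.isVershikImage_vershikFun hξ
  obtain ⟨n, h1, h2, h3, h4, h5⟩ := hη
  filter_upwards [(B.isOpen_agree ξ (max n i)).mem_nhds fun _ _ => rfl] with ξ' hξ'
  let ζ : ∀ j, B.E j := fun j => if j ≤ n then (B.vershikFun ξ).1 j else ξ'.1 j
  have ζle : ∀ j ≤ n, ζ j = (B.vershikFun ξ).1 j := fun j hj => by simp [ζ, hj]
  have ζgt : ∀ j > n, ζ j = ξ'.1 j := fun j hj => by simp [ζ, Nat.not_le.2 hj]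
  have hle : ∀ j ≤ n, ξ'.1 j = ξ.1 j := fun j hj => hξ' j (le_max_of_le_left hj)
  have hζ : ∀ j, B.rng j (ζ j) = B.src (j + 1) (ζ (j + 1)) := by
    intro j
    rcases lt_trichotomy j n with hj | rfl | hj
    · rw [ζle j hj.le, ζle (j + 1) hj, (B.vershikFun ξ).2]
    · rw [ζle j le_rfl, ζgt (j + 1) (Nat.lt_succ_self j), ← ξ'.2, hle j le_rfl]
      exact (B.rng_eq_of_le h3.le).symm
    · rw [ζgt j hj, ζgt (j + 1) (by omega), ξ'.2]
  have himg : B.IsVershikImage ξ' ⟨ζ, hζ⟩ := by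
    refine ⟨n, fun j hj => ?_, ?_, ?_, fun j hj => ?_, ζgt⟩
    · rw [hle j hj.le]
      exact h1 j hj
    · rw [hle n le_rfl]
      exact h2
    · show ξ'.1 n ⋖ ζ n
      rw [hle n le_rfl, ζle n le_rfl]
      exact h3
    · show IsMin (ζ j)
      rw [ζle j hj.le]
      exact h4 j hj
  have heq := (B.isVershikImage_vershikFun himg.notMem_maxPaths).unique himg
  show (B.vershikFun ξ').1 i = (B.vershikFun ξ).1 i
  rw [heq]
  show ζ i = _
  rcases le_or_gt i n with hi | hi
  · exact ζle i hi
  · rw [ζgt i hi, hξ' i (le_max_right _ _), h5 i hi]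

theorem isVershikImage_dual_vershikFun (B : OrderedBratteliDiagram) {η : B.PathSpace}
    (hη : η ∉ B.minPaths) : B.IsVershikImage (B.dual.vershikFun η) η :=
  (B.isVershikImage_dual _ η).1 (B.dual.isVershikImage_vershikFun hη)

/-- The Vershik map `λ : X_B \ X_B^max → X_B \ X_B^min`. -/
noncomputable def vershik (B : OrderedBratteliDiagram) :
    OpenPartialHomeomorph B.PathSpace B.PathSpace where
  toFun := B.vershikFun
  invFun := B.dual.vershikFun
  source := B.maxPathsᶜ
  target := B.minPathsᶜ
  map_source' _ hξ := (B.isVershikImage_vershikFun hξ).notMem_minPaths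
  map_target' _ hη := (B.isVershikImage_dual_vershikFun hη).notMem_maxPaths
  left_inv' ξ hξ := by
    have h := B.isVershikImage_vershikFun hξ
    have h' := B.dual.isVershikImage_vershikFun h.notMem_minPaths
    exact h'.unique ((B.isVershikImage_dual _ _).2 h)
  right_inv' η hη := by
    have h := B.isVershikImage_dual_vershikFun hη
    exact (B.isVershikImage_vershikFun h.notMem_maxPaths).unique h
  open_source := B.isOpen_compl_maxPaths
  open_target := B.dual.isOpen_compl_maxPaths
  continuousOn_toFun := B.continuousOn_vershikFun
  continuousOn_invFun := B.dual.continuousOn_vershikFun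

end OrderedBratteliDiagram

/-- A Kakutani–Rokhlin partition for a homeomorphism `h : U → V` between open sets, where
`X_U = h.sourceᶜ` and `X_V = h.targetᶜ`: a partition of `X` into nonempty clopen sets `E k j`, with
`k < K` and `j < J k`. The levels of a tower are numbered from `0`, so that `E k 0` is the base and
`E k (J k - 1)` is the top of the tower `k`; the sets `E k j` with `J k ≤ j` play no role. -/
structure KRPartition {X : Type*} [TopologicalSpace X] (h : OpenPartialHomeomorph X X) where
  K : ℕ
  J : Fin K → ℕ
  E : Fin K → ℕ → Set X
  K_pos : 0 < K
  J_pos : ∀ k, 0 < J k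
  isClopen : ∀ k, ∀ j < J k, IsClopen (E k j)
  nonempty : ∀ k, ∀ j < J k, (E k j).Nonempty
  disjoint : ∀ k, ∀ j < J k, ∀ k', ∀ j' < J k', ¬ (k = k' ∧ j = j') → Disjoint (E k j) (E k' j')
  cover : ∀ x, ∃ k, ∃ j < J k, x ∈ E k j
  compl_source_subset : h.sourceᶜ ⊆ ⋃ k, E k (J k - 1)
  compl_target_subset : h.targetᶜ ⊆ ⋃ k, E k 0
  image_eq : ∀ k j, j + 1 < J k → h '' E k j = E k (j + 1)
  image_top : (⋃ k, h '' (E k (J k - 1) \ h.sourceᶜ)) ∪ h.targetᶜ = ⋃ k, E k 0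

namespace KRPartition

variable {X : Type*} [TopologicalSpace X] {h : OpenPartialHomeomorph X X}

/-- The union of the bases of the towers. -/
def base (P : KRPartition h) : Set X := ⋃ k, P.E k 0

/-- `Q` is finer than `P`. -/
def IsFiner (Q P : KRPartition h) : Prop :=
  ∀ k, ∀ j < Q.J k, ∃ m, ∃ i < P.J m, Q.E k j ⊆ P.E m i

theorem index_eq (P : KRPartition h) {x : X} {k k' : Fin P.K} {j j' : ℕ} (hj : j < P.J k)
    (hj' : j' < P.J k') (hx : x ∈ P.E k j) (hx' : x ∈ P.E k' j') : k = k' ∧ j = j' := by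
  by_contra hne
  exact Set.disjoint_left.1 (P.disjoint k j hj k' j' hj' hne) hx hx'

/-- If the level `j` of a tower of `Q` lies in the base of a tower of `P`, then the tower of `Q`
passes through the tower of `P` from its level `j` on. -/
theorem passes_through {P Q : KRPartition h} (hbase : Q.base ⊆ P.base) {k : Fin Q.K}
    {m : Fin P.K} {j : ℕ} (hj : j < Q.J k) (hsub : Q.E k j ⊆ P.E m 0) :
    ∀ i < P.J m, j + i < Q.J k ∧ Q.E k (j + i) ⊆ P.E m i := by
  intro i
  induction i with
  | zero => exact fun _ => ⟨hj, hsub⟩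
  | succ i ih =>
    intro hi
    obtain ⟨hlt, hsub'⟩ := ih (by omega)
    have hlt' : j + (i + 1) < Q.J k := by
      by_contra hge
      obtain ⟨x, hx⟩ := Q.nonempty k (j + i) hlt
      have hxU : x ∈ h.source := by
        by_contra hxU
        obtain ⟨m', hm'⟩ := Set.mem_iUnion.1 (P.compl_source_subset hxU)
        have hpos := P.J_pos m'
        obtain ⟨rfl, hi'⟩ := P.index_eq (by omega) (by omega) (hsub' hx) hm'
        omega
      have hb : h x ∈ Q.base := by
        rw [base, ← Q.image_top]
        refine Or.inl (Set.mem_iUnion.2 ⟨k, x, ⟨?_, fun hc => hc hxU⟩, rfl⟩)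
        rwa [show Q.J k - 1 = j + i by omega]
      obtain ⟨m', hm'⟩ := Set.mem_iUnion.1 (hbase hb)
      have hx' : h x ∈ P.E m (i + 1) := P.image_eq m i hi ▸ Set.mem_image_of_mem h (hsub' hx)
      have := (P.index_eq hi (P.J_pos m') hx' hm').2
      omega
    refine ⟨hlt', ?_⟩
    rw [← add_assoc, ← Q.image_eq k (j + i) hlt', ← P.image_eq m i hi]
    exact Set.image_mono hsub'

end KRPartition

/-- A sequence of Kakutani–Rokhlin partitions `P n`, `n ≥ 0`, that starts with the partition `{X}`
into a single set, such that the unions of the bases decrease to `X_V`, each `P (n + 1)` is finer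
than `P n`, and the sets in all the partitions generate the topology of `X`. -/
structure KRSequence {X : Type*} [tX : TopologicalSpace X] (h : OpenPartialHomeomorph X X) where
  P : ℕ → KRPartition h
  K_zero : (P 0).K = 1
  J_zero : ∀ k, (P 0).J k = 1
  E_zero : ∀ k, (P 0).E k 0 = Set.univ
  base_succ_subset : ∀ n, (P (n + 1)).base ⊆ (P n).base
  iInter_base : ⋂ n, (P n).base = h.targetᶜ
  finer : ∀ n, (P (n + 1)).IsFiner (P n)
  generates : tX =
    TopologicalSpace.generateFrom {A | ∃ n k, ∃ j < (P n).J k, A = (P n).E k j}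

namespace KRSequence

variable {X : Type*} [TopologicalSpace X] {h : OpenPartialHomeomorph X X}

/-- The edges from level `n` to level `n + 1`: one for each time a tower `T_{(n+1,k)}` passes
through a tower `T_{(n,m)}`, namely the triples `(m, k, j')` with `E (n+1) k (j' + j) ⊆ E n m j` for
each level `j` of `T_{(n,m)}`. -/
@[ext]
structure Edge (S : KRSequence h) (n : ℕ) where
  m : Fin (S.P n).K
  k : Fin (S.P (n + 1)).K
  offset : ℕ
  offset_add_le : offset + (S.P n).J m ≤ (S.P (n + 1)).J k
  subset : ∀ j < (S.P n).J m, (S.P (n + 1)).E k (offset + j) ⊆ (S.P n).E m j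

theorem Edge.offset_lt {S : KRSequence h} {n : ℕ} (e : S.Edge n) :
    e.offset < (S.P (n + 1)).J e.k := by
  have := (S.P n).J_pos e.m
  have := e.offset_add_le
  omega

theorem Edge.ext_offset {S : KRSequence h} {n : ℕ} {e e' : S.Edge n} (hk : e.k = e'.k)
    (ho : e.offset = e'.offset) : e = e' := by
  obtain ⟨x, hx⟩ := (S.P (n + 1)).nonempty e.k e.offset e.offset_lt
  have h1 := e.subset 0 ((S.P n).J_pos _) hx
  rw [hk, ho] at hx
  have h2 := e'.subset 0 ((S.P n).J_pos _) hx
  exact Edge.ext ((S.P n).index_eq ((S.P n).J_pos _) ((S.P n).J_pos _) h1 h2).1 hk ho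

theorem exists_edge (S : KRSequence h) {n : ℕ} {m : Fin (S.P n).K} {k : Fin (S.P (n + 1)).K}
    {j : ℕ} (hj : j < (S.P (n + 1)).J k) (hsub : (S.P (n + 1)).E k j ⊆ (S.P n).E m 0) :
    ∃ e : S.Edge n, e.m = m ∧ e.k = k := by
  have hp := KRPartition.passes_through (S.base_succ_subset n) hj hsub
  have hpos := (S.P n).J_pos m
  have hlast := (hp ((S.P n).J m - 1) (by omega)).1
  exact ⟨⟨m, k, j, by omega, fun i hi => (hp i hi).2⟩, rfl, rfl⟩

theorem exists_edge_to (S : KRSequence h) (n : ℕ) (k : Fin (S.P (n + 1)).K) :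
    ∃ e : S.Edge n, e.k = k := by
  have hpos := (S.P (n + 1)).J_pos k
  obtain ⟨m, i, hi, hsub⟩ := S.finer n k 0 hpos
  obtain ⟨x, hx⟩ := (S.P (n + 1)).nonempty k 0 hpos
  obtain ⟨m', hm'⟩ := Set.mem_iUnion.1 (S.base_succ_subset n (Set.mem_iUnion.2 ⟨k, hx⟩))
  obtain ⟨rfl, rfl⟩ := (S.P n).index_eq hi ((S.P n).J_pos m') (hsub hx) hm'
  obtain ⟨e, -, he⟩ := S.exists_edge hpos hsub
  exact ⟨e, he⟩

theorem exists_edge_from (S : KRSequence h) (n : ℕ) (m : Fin (S.P n).K) :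
    ∃ e : S.Edge n, e.m = m := by
  have hpos := (S.P n).J_pos m
  obtain ⟨x, hx⟩ := (S.P n).nonempty m 0 hpos
  obtain ⟨k, j, hj, hxj⟩ := (S.P (n + 1)).cover x
  obtain ⟨m', i, hi, hsub⟩ := S.finer n k j hj
  obtain ⟨rfl, rfl⟩ := (S.P n).index_eq hi hpos (hsub hxj) hx
  obtain ⟨e, he, -⟩ := S.exists_edge hj hsub
  exact ⟨e, he⟩

/-- Edges with the same range are ordered by their offsets. -/
instance (S : KRSequence h) (n : ℕ) : PartialOrder (S.Edge n) where
  le e e' := e.k = e'.k ∧ e.offset ≤ e'.offset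
  le_refl _ := ⟨rfl, le_rfl⟩
  le_trans _ _ _ h1 h2 := ⟨h1.1.trans h2.1, h1.2.trans h2.2⟩
  le_antisymm _ _ h1 h2 := Edge.ext_offset h1.1 (le_antisymm h1.2 h2.2)

/-- The ordered Bratteli diagram constructed from a sequence of Kakutani–Rokhlin partitions: the
vertices at level `n` are the towers of the `n`-th partition. -/
def toDiagram (S : KRSequence h) : OrderedBratteliDiagram where
  V n := Fin (S.P n).K
  E n := S.Edge n
  src _ e := e.m
  rng _ e := e.k
  finite_V _ := inferInstance
  nonempty_V n := ⟨⟨0, (S.P n).K_pos⟩⟩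
  card_root := by rw [Nat.card_fin, S.K_zero]
  finite_E n := Finite.of_injective
    (fun e : S.Edge n => (⟨e.k, e.offset, e.offset_lt⟩ : Σ k, Fin ((S.P (n + 1)).J k)))
    (fun e e' hee => by
      have hk : e.k = e'.k := congrArg Sigma.fst hee
      have ho : e.offset = e'.offset :=
        congrArg (fun p : Σ k, Fin ((S.P (n + 1)).J k) => (p.2 : ℕ)) hee
      exact Edge.ext_offset hk ho)
  nonempty_E n := ⟨(S.exists_edge_to n ⟨0, (S.P (n + 1)).K_pos⟩).choose⟩
  src_surjective := S.exists_edge_from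
  rng_surjective := S.exists_edge_to
  order _ := inferInstance
  comparable_iff _ e e' :=
    ⟨fun hc => hc.elim (fun hle => hle.1) (fun hle => hle.1.symm),
      fun hk => (le_total e.offset e'.offset).imp (fun ho => ⟨hk, ho⟩) (fun ho => ⟨hk.symm, ho⟩)⟩

end KRSequence

/-! A point `x` has coordinates in every partition: its tower and its level there. Bases decrease
and partitions refine, so a tower of stage `n + 1` meeting a tower of stage `n` traverses all of it.
Hence the difference of consecutive levels of `x` is the offset of an edge, and these edges form the
path of `x` (`exists_pathEdge`, `path`).

Levels at stage 0 vanish, so the level at stage `n` is the sum of the first `n` offsets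
(`pathEdge_offset`). A path is therefore the same as a nested sequence of nonempty clopen cells:
compactness puts a point in their intersection, and only one, because the cells generate the
topology. The resulting continuous bijection from a compact space to a Hausdorff space is a
homeomorphism.

For the dynamics, `h` raises the level by one below the top of a tower and sends a top point of `U`
to the base. Minimal edges start at the bottom of a tower and maximal ones end at its top
(`isMin_edge_iff`, `isMax_edge_iff`), so the first non-maximal edge marks the last stage at which
`x` is at the top. Up to that stage `h x` lies in the base, and beyond it only the level changes, by
one: this is the Vershik rule (`isVershikImage_path`). -/

namespace PartialAction

open OpenPartialHomeomorph

/-! ### From one-step conjugacy to morphisms of partial actions -/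

theorem toPartialAction_isMorphism {X Y : Type*} [TopologicalSpace X] [TopologicalSpace Y]
    {f : OpenPartialHomeomorph X X} {g : OpenPartialHomeomorph Y Y} {φ : X → Y}
    (hφ : Continuous φ) (hrel : ∀ n x y, ZPowRel f n x y → ZPowRel g n (φ x) (φ y)) :
    IsMorphism f.toPartialAction g.toPartialAction φ := by
  refine ⟨hφ, fun t y hy => ?_, fun t x hx => ?_⟩
  · obtain ⟨x, hx⟩ := (mem_target_partialZPow_iff f t y).1 hy
    exact (mem_target_partialZPow_iff g t (φ y)).2 ⟨φ x, hrel t x y hx⟩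
  · have hx' : x ∈ (partialZPow f t).source := f.toPartialAction.act_source t ▸ hx
    exact (hrel t x _ ⟨hx', rfl⟩).2

end PartialAction

namespace OpenPartialHomeomorph

/-- Induction settles `n ≥ 0`, and a negative power is a positive one with its endpoints exchanged.
Nothing is assumed about `φ` off `f.source`, so an isomorphism needs this for the inverse map too.
-/
theorem zPowRel_of_semiconj {X Y : Type*} [TopologicalSpace X] [TopologicalSpace Y]
    {f : OpenPartialHomeomorph X X} {g : OpenPartialHomeomorph Y Y} {φ : X → Y}
    (hφ : ∀ x ∈ f.source, φ x ∈ g.source ∧ g (φ x) = φ (f x)) (n : ℤ) (x y : X)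
    (hxy : ZPowRel f n x y) : ZPowRel g n (φ x) (φ y) := by
  have key : ∀ (n : ℕ) (x y : X), ZPowRel f n x y → ZPowRel g n (φ x) (φ y) := by
    intro n
    induction n with
    | zero => exact fun x y hxy => (zPowRel_zero g _ _).2 (congrArg φ ((zPowRel_zero f x y).1 hxy))
    | succ n ih =>
      intro x z hxz
      obtain ⟨y, hxy, hyz⟩ := (zPowRel_natCast_add f n 1 x z).1 hxz
      refine (zPowRel_natCast_add g n 1 _ _).2 ⟨φ y, ih x y hxy, ?_⟩
      obtain ⟨⟨-, hy⟩, rfl⟩ := hyz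
      exact ⟨⟨trivial, (hφ y hy).1⟩, (hφ y hy).2⟩
  obtain ⟨k, rfl | rfl⟩ := n.eq_nat_or_neg
  · exact key k x y hxy
  · rw [zPowRel_neg] at hxy ⊢
    exact key k y x hxy

end OpenPartialHomeomorph

/-! ### Tower and level coordinates of a point -/

namespace KRPartition

variable {X : Type*} [TopologicalSpace X] {h : OpenPartialHomeomorph X X}

/-- The index of the tower that contains `x`. -/
noncomputable def tower (P : KRPartition h) (x : X) : Fin P.K := (P.cover x).choose

/-- The level of `x` in the tower that contains it. -/
noncomputable def level (P : KRPartition h) (x : X) : ℕ := (P.cover x).choose_spec.choose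

theorem level_lt (P : KRPartition h) (x : X) : P.level x < P.J (P.tower x) :=
  (P.cover x).choose_spec.choose_spec.1

theorem mem_cell (P : KRPartition h) (x : X) : x ∈ P.E (P.tower x) (P.level x) :=
  (P.cover x).choose_spec.choose_spec.2

theorem tower_level_eq (P : KRPartition h) {x : X} {k : Fin P.K} {j : ℕ} (hj : j < P.J k)
    (hx : x ∈ P.E k j) : P.tower x = k ∧ P.level x = j :=
  P.index_eq (P.level_lt x) hj (P.mem_cell x) hx

theorem tower_eq (P : KRPartition h) {x : X} {k : Fin P.K} {j : ℕ} (hj : j < P.J k)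
    (hx : x ∈ P.E k j) : P.tower x = k :=
  (P.tower_level_eq hj hx).1

theorem level_eq (P : KRPartition h) {x : X} {k : Fin P.K} {j : ℕ} (hj : j < P.J k)
    (hx : x ∈ P.E k j) : P.level x = j :=
  (P.tower_level_eq hj hx).2

theorem mem_base_iff (P : KRPartition h) (x : X) : x ∈ P.base ↔ P.level x = 0 := by
  refine ⟨fun hx => ?_, fun hx => Set.mem_iUnion.2 ⟨P.tower x, hx ▸ P.mem_cell x⟩⟩
  obtain ⟨k, hk⟩ := Set.mem_iUnion.1 hx
  exact P.level_eq (P.J_pos k) hk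

theorem subset_source (P : KRPartition h) {k : Fin P.K} {j : ℕ} (hj : j + 1 < P.J k) :
    P.E k j ⊆ h.source := by
  intro x hx
  by_contra hxU
  obtain ⟨k', hk'⟩ := Set.mem_iUnion.1 (P.compl_source_subset hxU)
  have hpos := P.J_pos k'
  obtain ⟨rfl, hi⟩ := P.index_eq (by omega) (by omega) hx hk'
  omega

theorem level_add_one_eq_of_notMem_source (P : KRPartition h) {x : X} (hx : x ∉ h.source) :
    P.level x + 1 = P.J (P.tower x) := by
  by_contra hne
  have hlt := P.level_lt x
  exact hx (P.subset_source (by omega) (P.mem_cell x))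

theorem tower_level_apply (P : KRPartition h) {x : X} (hx : P.level x + 1 < P.J (P.tower x)) :
    P.tower (h x) = P.tower x ∧ P.level (h x) = P.level x + 1 :=
  P.tower_level_eq hx (P.image_eq _ _ hx ▸ Set.mem_image_of_mem h (P.mem_cell x))

theorem level_apply_of_top (P : KRPartition h) {x : X} (hxU : x ∈ h.source)
    (hx : P.level x + 1 = P.J (P.tower x)) : P.level (h x) = 0 := by
  rw [← mem_base_iff, base, ← P.image_top]
  refine Or.inl (Set.mem_iUnion.2 ⟨P.tower x, x, ⟨?_, fun hc => hc hxU⟩, rfl⟩)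
  rw [← hx]
  exact P.mem_cell x

theorem isOpen_cell (P : KRPartition h) (x : X) :
    IsOpen (P.E (P.tower x) (P.level x)) :=
  (P.isClopen _ _ (P.level_lt x)).isOpen

theorem cell_subset {P Q : KRPartition h} (hQP : Q.IsFiner P) (x : X) :
    Q.E (Q.tower x) (Q.level x) ⊆ P.E (P.tower x) (P.level x) := by
  obtain ⟨m, i, hi, hsub⟩ := hQP (Q.tower x) (Q.level x) (Q.level_lt x)
  obtain ⟨h1, h2⟩ := P.tower_level_eq hi (hsub (Q.mem_cell x))
  rwa [h1, h2]

/-- A tower of `Q` that meets level `i` of a tower of `P` passes through the base of that tower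
`i` steps earlier. -/
theorem sub_subset_base {P Q : KRPartition h} (hbase : Q.base ⊆ P.base) {k : Fin Q.K}
    {m : Fin P.K} : ∀ {i j : ℕ}, j < Q.J k → i < P.J m → Q.E k j ⊆ P.E m i →
      i ≤ j ∧ Q.E k (j - i) ⊆ P.E m 0 := by
  intro i
  induction i with
  | zero => exact fun _ _ hsub => ⟨Nat.zero_le _, hsub⟩
  | succ i ih =>
    intro j hj hi hsub
    cases j with
    | zero =>
      -- The base of `Q` lies in the base of `P`, so it cannot meet a positive level of `P`.
      obtain ⟨x, hx⟩ := Q.nonempty k 0 hj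
      have h0 := (P.mem_base_iff x).1 (hbase (Set.mem_iUnion.2 ⟨k, hx⟩))
      rw [P.level_eq hi (hsub hx)] at h0
      omega
    | succ j =>
      -- Neither cell is a top, so both lie in the source of `h`, where injectivity lets the
      -- inclusion be pulled back one step.
      have hsub' : Q.E k j ⊆ P.E m i := by
        intro x hx
        have hx' : h x ∈ P.E m (i + 1) :=
          hsub (Q.image_eq k j hj ▸ Set.mem_image_of_mem h hx)
        rw [← P.image_eq m i hi] at hx'
        obtain ⟨y, hy, hyx⟩ := hx'
        rwa [← h.injOn (P.subset_source hi hy) (Q.subset_source hj hx) hyx]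
      obtain ⟨h1, h2⟩ := ih (by omega) (by omega) hsub'
      refine ⟨by omega, ?_⟩
      rwa [Nat.add_sub_add_right]

end KRPartition

/-! ### The path of a point -/

namespace KRSequence

variable {X : Type*} [TopologicalSpace X] {h : OpenPartialHomeomorph X X}

theorem level_le_and_subset (S : KRSequence h) (n : ℕ) (x : X) :
    (S.P n).level x ≤ (S.P (n + 1)).level x ∧
      (S.P (n + 1)).E ((S.P (n + 1)).tower x) ((S.P (n + 1)).level x - (S.P n).level x) ⊆
        (S.P n).E ((S.P n).tower x) 0 :=
  KRPartition.sub_subset_base (S.base_succ_subset n) ((S.P (n + 1)).level_lt x)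
    ((S.P n).level_lt x) (KRPartition.cell_subset (S.finer n) x)

/-- An edge starts wherever a tower passes through a base of the previous partition. -/
theorem exists_edge_offset (S : KRSequence h) {n : ℕ} {m : Fin (S.P n).K}
    {k : Fin (S.P (n + 1)).K} {j : ℕ} (hj : j < (S.P (n + 1)).J k)
    (hsub : (S.P (n + 1)).E k j ⊆ (S.P n).E m 0) :
    ∃ e : S.Edge n, e.m = m ∧ e.k = k ∧ e.offset = j := by
  have hp := KRPartition.passes_through (S.base_succ_subset n) hj hsub
  have hpos := (S.P n).J_pos m
  have hlast := (hp ((S.P n).J m - 1) (by omega)).1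
  exact ⟨⟨m, k, j, by omega, fun i hi => (hp i hi).2⟩, rfl, rfl, rfl⟩

theorem exists_pathEdge (S : KRSequence h) (n : ℕ) (x : X) :
    ∃ e : S.Edge n, e.m = (S.P n).tower x ∧ e.k = (S.P (n + 1)).tower x ∧
      e.offset = (S.P (n + 1)).level x - (S.P n).level x :=
  S.exists_edge_offset (lt_of_le_of_lt (Nat.sub_le _ _) ((S.P (n + 1)).level_lt x))
    (S.level_le_and_subset n x).2

/-- The edge along which the itinerary of `x` goes from level `n` to level `n + 1`. -/
noncomputable def pathEdge (S : KRSequence h) (n : ℕ) (x : X) : S.Edge n :=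
  (S.exists_pathEdge n x).choose

theorem pathEdge_m (S : KRSequence h) (n : ℕ) (x : X) :
    (S.pathEdge n x).m = (S.P n).tower x :=
  (S.exists_pathEdge n x).choose_spec.1

theorem pathEdge_k (S : KRSequence h) (n : ℕ) (x : X) :
    (S.pathEdge n x).k = (S.P (n + 1)).tower x :=
  (S.exists_pathEdge n x).choose_spec.2.1

/-- The subtraction defining the offset is not truncated, as levels do not decrease with the stage.
Telescoping this identity recovers levels from edges. -/
theorem pathEdge_offset (S : KRSequence h) (n : ℕ) (x : X) :
    (S.pathEdge n x).offset + (S.P n).level x = (S.P (n + 1)).level x := by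
  rw [pathEdge, (S.exists_pathEdge n x).choose_spec.2.2]
  exact Nat.sub_add_cancel (S.level_le_and_subset n x).1

theorem level_zero (S : KRSequence h) (x : X) : (S.P 0).level x = 0 := by
  have hlt := (S.P 0).level_lt x
  rw [S.J_zero] at hlt
  omega

/-- The path that records the towers and levels of `x` in the partitions. -/
noncomputable def path (S : KRSequence h) (x : X) : S.toDiagram.PathSpace :=
  ⟨fun n => S.pathEdge n x, fun n => (S.pathEdge_k n x).trans (S.pathEdge_m (n + 1) x).symm⟩

/-- No assumption on the towers at stage `n` is needed: range and offset already determine an edge.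
-/
theorem pathEdge_eq_of_cell_eq (S : KRSequence h) {n : ℕ} {x y : X}
    (hl : (S.P n).level x = (S.P n).level y)
    (ht' : (S.P (n + 1)).tower x = (S.P (n + 1)).tower y)
    (hl' : (S.P (n + 1)).level x = (S.P (n + 1)).level y) : S.pathEdge n x = S.pathEdge n y := by
  have hx := S.pathEdge_offset n x
  have hy := S.pathEdge_offset n y
  exact Edge.ext_offset (by rw [pathEdge_k, pathEdge_k, ht']) (by omega)

/-! ### The path map is a continuous bijection -/

theorem continuous_path (S : KRSequence h) : Continuous S.path := by
  let _ : ∀ i, TopologicalSpace (S.toDiagram.E i) := fun _ => ⊥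
  have hdisc : ∀ i, DiscreteTopology (S.toDiagram.E i) := fun _ => ⟨rfl⟩
  refine continuous_induced_rng.2 (continuous_pi fun n => ?_)
  refine continuous_iff_continuousAt.2 fun x => ?_
  change Filter.Tendsto (fun x => S.pathEdge n x) (nhds x)
    (@nhds (S.toDiagram.E n) _ (S.pathEdge n x))
  rw [nhds_discrete (S.toDiagram.E n)]
  refine Filter.tendsto_pure.2 ?_
  -- The edge is constant on the intersection of the cells of `x` at stages `n` and `n + 1`, an open
  -- set.
  filter_upwards [((S.P n).isOpen_cell x).mem_nhds ((S.P n).mem_cell x),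
    ((S.P (n + 1)).isOpen_cell x).mem_nhds ((S.P (n + 1)).mem_cell x)] with y hy hy'
  obtain ⟨ht', hl'⟩ := (S.P (n + 1)).tower_level_eq ((S.P (n + 1)).level_lt x) hy'
  exact S.pathEdge_eq_of_cell_eq ((S.P n).level_eq ((S.P n).level_lt x) hy) ht' hl'

theorem injective_path [T0Space X] (S : KRSequence h) : Function.Injective S.path := by
  intro x y hxy
  have hedge : ∀ n, S.pathEdge n x = S.pathEdge n y := fun n =>
    congrFun (congrArg Subtype.val hxy) n
  have htower : ∀ n, (S.P n).tower x = (S.P n).tower y := fun n => by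
    rw [← pathEdge_m, ← pathEdge_m, hedge]
  have hlevel : ∀ n, (S.P n).level x = (S.P n).level y := by
    intro n
    induction n with
    | zero => rw [level_zero, level_zero]
    | succ n ih => rw [← pathEdge_offset, ← pathEdge_offset, hedge, ih]
  -- Both points have the same coordinates at every stage, hence lie in the same subbasic sets; the
  -- T0 axiom then identifies them.
  have hinsep : Inseparable x y := by
    refine TopologicalSpace.IsTopologicalBasis.inseparable_iff
      (TopologicalSpace.isTopologicalBasis_of_subbasis S.generates) |>.2 ?_
    rintro _ ⟨F, ⟨-, hF⟩, rfl⟩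
    have hcell : ∀ A ∈ F, (x ∈ A ↔ y ∈ A) := by
      intro A hA
      obtain ⟨n, k, j, hj, rfl⟩ := hF hA
      constructor
      · intro hx
        obtain ⟨rfl, rfl⟩ := (S.P n).tower_level_eq hj hx
        rw [htower, hlevel]
        exact (S.P n).mem_cell y
      · intro hy
        obtain ⟨rfl, rfl⟩ := (S.P n).tower_level_eq hj hy
        rw [← htower, ← hlevel]
        exact (S.P n).mem_cell x
    simp only [Set.mem_sInter]
    exact forall₂_congr hcell
  exact hinsep.eq

theorem surjective_path [CompactSpace X] (S : KRSequence h) : Function.Surjective S.path := by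
  intro ξ
  let e : ∀ n, S.Edge n := ξ.1
  have he : ∀ n, (e n).k = (e (n + 1)).m := ξ.2
  -- The levels that a preimage of `ξ` is forced to have.
  let l : ℕ → ℕ := fun n => ∑ i ∈ Finset.range n, (e i).offset
  have l_succ : ∀ n, l (n + 1) = (e n).offset + l n := fun n => by
    simp only [l, Finset.sum_range_succ, add_comm]
  have hl : ∀ n, l n < (S.P n).J (e n).m := by
    intro n
    induction n with
    | zero => exact (S.P 0).J_pos _
    | succ n ih =>
      rw [l_succ, ← he]
      have := (e n).offset_add_le
      omega
  -- The cells are nested by the inclusions that define the edges.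
  obtain ⟨x, hx⟩ : (⋂ n, (S.P n).E (e n).m (l n)).Nonempty := by
    refine IsCompact.nonempty_iInter_of_sequence_nonempty_isCompact_isClosed _ (fun n => ?_)
      (fun n => (S.P n).nonempty _ _ (hl n)) ((S.P 0).isClopen _ _ (hl 0)).isClosed.isCompact
      fun n => ((S.P n).isClopen _ _ (hl n)).isClosed
    rw [l_succ, ← he]
    exact (e n).subset _ (hl n)
  rw [Set.mem_iInter] at hx
  have ht : ∀ n, (S.P n).tower x = (e n).m := fun n => (S.P n).tower_eq (hl n) (hx n)
  have hlev : ∀ n, (S.P n).level x = l n := fun n => (S.P n).level_eq (hl n) (hx n)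
  refine ⟨x, Subtype.ext (funext fun n => ?_)⟩
  have ho := S.pathEdge_offset n x
  rw [hlev, hlev, l_succ] at ho
  exact Edge.ext_offset (e := S.pathEdge n x) (e' := e n)
    (by rw [pathEdge_k, ht, he]) (by omega)

/-! ### Extremal edges and extremal paths -/

theorem isMin_edge_iff (S : KRSequence h) {n : ℕ} (e : S.Edge n) : IsMin e ↔ e.offset = 0 := by
  constructor
  · intro hmin
    have hpos := (S.P (n + 1)).J_pos e.k
    obtain ⟨m, i, hi, hsub⟩ := S.finer n e.k 0 hpos
    -- The bottom of the tower lies in a base of stage `n`, so some edge into the same vertex has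
    -- offset 0.
    have hi0 := (KRPartition.sub_subset_base (S.base_succ_subset n) hpos hi hsub).1
    obtain rfl : i = 0 := by omega
    obtain ⟨e', -, hk, ho⟩ := S.exists_edge_offset hpos hsub
    have hle : e ≤ e' := hmin (show e' ≤ e from ⟨hk, by omega⟩)
    have := hle.2
    omega
  · exact fun h0 e' hle => ⟨hle.1.symm, by omega⟩

/-- Two edges with the same range pass through disjoint ranges of levels. -/
theorem offset_add_le_of_lt (S : KRSequence h) {n : ℕ} {e e' : S.Edge n} (hlt : e < e') :
    e.offset + (S.P n).J e.m ≤ e'.offset := by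
  have hk : e.k = e'.k := hlt.le.1
  have hle : e.offset ≤ e'.offset := hlt.le.2
  have hne : e.offset ≠ e'.offset := fun ho => hlt.ne (Edge.ext_offset hk ho)
  by_contra hcon
  -- If the passes overlapped, this point would have level 0 along `e'` and positive level along
  -- `e`.
  obtain ⟨x, hx⟩ := (S.P (n + 1)).nonempty e'.k e'.offset e'.offset_lt
  have h1 := e'.subset 0 ((S.P n).J_pos _) hx
  have h2 := e.subset (e'.offset - e.offset) (by omega)
    (show x ∈ _ by rwa [hk, Nat.add_sub_cancel' hle])
  have := ((S.P n).index_eq ((S.P n).J_pos _) (by omega) h1 h2).2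
  omega

theorem isMax_edge_iff (S : KRSequence h) {n : ℕ} (e : S.Edge n) :
    IsMax e ↔ e.offset + (S.P n).J e.m = (S.P (n + 1)).J e.k := by
  have hpos := (S.P n).J_pos e.m
  constructor
  · intro hmax
    by_contra hne
    have hle := e.offset_add_le
    have hlt : e.offset + (S.P n).J e.m < (S.P (n + 1)).J e.k := by omega
    -- Take `y` in the last level of the pass. If the big tower continues, `h y` stays in it and
    -- lies in a base of stage `n`, so the edge of `h y` is strictly later than `e`.
    obtain ⟨y, hy⟩ := (S.P (n + 1)).nonempty e.k (e.offset + ((S.P n).J e.m - 1)) (by omega)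
    have hyU := (S.P (n + 1)).subset_source (by omega) hy
    have hy' : h y ∈ (S.P (n + 1)).E e.k (e.offset + (S.P n).J e.m) := by
      have := Set.mem_image_of_mem h hy
      rwa [(S.P (n + 1)).image_eq _ _ (by omega), add_assoc, Nat.sub_add_cancel hpos] at this
    obtain ⟨ht, hl⟩ := (S.P n).tower_level_eq (by omega) (e.subset _ (by omega) hy)
    have h0 := (S.P n).level_apply_of_top hyU (by rw [ht, hl]; omega)
    obtain ⟨ht', hl'⟩ := (S.P (n + 1)).tower_level_eq hlt hy'
    have ho := S.pathEdge_offset n (h y)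
    have hle' : S.pathEdge n (h y) ≤ e :=
      hmax (show e ≤ S.pathEdge n (h y) from ⟨by rw [pathEdge_k, ht'], by omega⟩)
    have := hle'.2
    omega
  · intro heq e' hle
    rcases hle.eq_or_lt with rfl | hlt
    · exact le_rfl
    · have h1 := S.offset_add_le_of_lt hlt
      have h2 := e'.offset_lt
      rw [← hle.1] at h2
      omega

theorem isMax_pathEdge_iff (S : KRSequence h) {n : ℕ} {x : X}
    (hx : (S.P n).level x + 1 = (S.P n).J ((S.P n).tower x)) :
    IsMax (S.pathEdge n x) ↔
      (S.P (n + 1)).level x + 1 = (S.P (n + 1)).J ((S.P (n + 1)).tower x) := by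
  rw [isMax_edge_iff, pathEdge_m, pathEdge_k, ← S.pathEdge_offset n x, ← hx, add_assoc]

theorem top_of_isMax (S : KRSequence h) {n : ℕ} {x : X}
    (hx : ∀ i < n, IsMax (S.pathEdge i x)) :
    (S.P n).level x + 1 = (S.P n).J ((S.P n).tower x) := by
  induction n with
  | zero => rw [level_zero, S.J_zero]
  | succ n ih =>
    exact (S.isMax_pathEdge_iff (ih fun i hi => hx i (by omega))).1 (hx n (by omega))

/-- A point of `U` at the top at every stage would be sent into every base, hence into `X_V`,
although `h` takes values in `V`. Points of `X_U` are at the top at every stage by definition of the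
partitions. -/
theorem path_mem_maxPaths_iff (S : KRSequence h) (x : X) :
    S.path x ∈ S.toDiagram.maxPaths ↔ x ∉ h.source := by
  constructor
  · intro hmax hxU
    have hV : h x ∈ h.targetᶜ := by
      rw [← S.iInter_base, Set.mem_iInter]
      exact fun n => ((S.P n).mem_base_iff _).2
        ((S.P n).level_apply_of_top hxU (S.top_of_isMax fun i _ => hmax i))
    exact hV (h.map_source hxU)
  · exact fun hx n => (S.isMax_pathEdge_iff ((S.P n).level_add_one_eq_of_notMem_source hx)).2
      ((S.P (n + 1)).level_add_one_eq_of_notMem_source hx)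

theorem path_mem_minPaths_iff (S : KRSequence h) (x : X) :
    S.path x ∈ S.toDiagram.minPaths ↔ x ∉ h.target := by
  have hiff : x ∉ h.target ↔ ∀ n, (S.P n).level x = 0 := by
    rw [← Set.mem_compl_iff, ← S.iInter_base, Set.mem_iInter]
    exact forall_congr' fun n => (S.P n).mem_base_iff x
  have hmin : S.path x ∈ S.toDiagram.minPaths ↔ ∀ n, (S.pathEdge n x).offset = 0 :=
    forall_congr' fun n => S.isMin_edge_iff (S.pathEdge n x)
  rw [hiff, hmin]
  constructor
  · intro h0 n
    induction n with
    | zero => exact S.level_zero x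
    | succ n ih => rw [← pathEdge_offset, h0, ih]
  · intro h0 n
    have := S.pathEdge_offset n x
    rw [h0 (n + 1)] at this
    omega

/-! ### Conjugacy with the Vershik map -/

theorem not_top_of_le (S : KRSequence h) {n : ℕ} {x : X}
    (hx : (S.P n).level x + 1 < (S.P n).J ((S.P n).tower x)) {i : ℕ} (hi : n ≤ i) :
    (S.P i).level x + 1 < (S.P i).J ((S.P i).tower x) := by
  induction i, hi using Nat.le_induction with
  | base => exact hx
  | succ i _ ih =>
    have h1 := (S.pathEdge i x).offset_add_le
    have h2 := S.pathEdge_offset i x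
    rw [pathEdge_m, pathEdge_k] at h1
    omega

theorem isVershikImage_path (S : KRSequence h) {x : X} (hx : x ∈ h.source) :
    S.toDiagram.IsVershikImage (S.path x) (S.path (h x)) := by
  classical
  have hex : ∃ n, ¬ IsMax (S.pathEdge n x) := by
    by_contra! hcon
    exact (S.path_mem_maxPaths_iff x).1 hcon hx
  let n := Nat.find hex
  have hn : ¬ IsMax (S.pathEdge n x) := Nat.find_spec hex
  have hlt : ∀ i < n, IsMax (S.pathEdge i x) := fun i hi => not_not.1 (Nat.find_min hex hi)
  -- Stage `n` is included: being at the top there depends only on the edges before `n`. Edge `n`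
  -- decides stage `n + 1`.
  have htop : ∀ i ≤ n, (S.P i).level x + 1 = (S.P i).J ((S.P i).tower x) := fun i hi =>
    S.top_of_isMax fun j hj => hlt j (by omega)
  have hbot : ∀ i ≤ n, (S.P i).level (h x) = 0 := fun i hi =>
    (S.P i).level_apply_of_top hx (htop i hi)
  have hnot : (S.P (n + 1)).level x + 1 < (S.P (n + 1)).J ((S.P (n + 1)).tower x) := by
    rw [S.isMax_pathEdge_iff (htop n le_rfl)] at hn
    have := (S.P (n + 1)).level_lt x
    omega
  have hstep : ∀ i > n, (S.P i).tower (h x) = (S.P i).tower x ∧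
      (S.P i).level (h x) = (S.P i).level x + 1 := fun i hi =>
    (S.P i).tower_level_apply (S.not_top_of_le hnot hi)
  have hk : (S.pathEdge n x).k = (S.pathEdge n (h x)).k := by
    rw [pathEdge_k, pathEdge_k, (hstep (n + 1) (by omega)).1]
  -- The pass of `h x` begins exactly where that of `x` ends. No edge fits between them, since it
  -- would need a positive height; this gives the covering relation.
  have ho : (S.pathEdge n x).offset + (S.P n).J (S.pathEdge n x).m =
      (S.pathEdge n (h x)).offset := by
    have h1 := S.pathEdge_offset n x
    have h2 := S.pathEdge_offset n (h x)
    rw [(hstep (n + 1) (by omega)).2, hbot n le_rfl] at h2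
    rw [pathEdge_m, ← htop n le_rfl]
    omega
  have hpos := (S.P n).J_pos (S.pathEdge n x).m
  refine ⟨n, hlt, hn, ?_, fun i hi => ?_, fun i hi => ?_⟩
  · show S.pathEdge n x ⋖ S.pathEdge n (h x)
    refine ⟨lt_of_le_of_ne ⟨hk, by omega⟩ fun heq => ?_, fun c hc hc' => ?_⟩
    · rw [← heq] at ho
      omega
    · have h1 := S.offset_add_le_of_lt hc
      have h2 := S.offset_add_le_of_lt hc'
      have h3 := (S.P n).J_pos c.m
      omega
  · refine (S.isMin_edge_iff (S.pathEdge i (h x))).2 ?_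
    have := S.pathEdge_offset i (h x)
    rw [hbot (i + 1) hi] at this
    omega
  · show S.pathEdge i (h x) = S.pathEdge i x
    refine Edge.ext_offset ?_ ?_
    · rw [pathEdge_k, pathEdge_k, (hstep (i + 1) (by omega)).1]
    · have h1 := S.pathEdge_offset i x
      have h2 := S.pathEdge_offset i (h x)
      rw [(hstep i hi).2, (hstep (i + 1) (by omega)).2] at h2
      omega

end KRSequence

/-! ### Assembling the isomorphism -/

theorem OrderedBratteliDiagram.t2Space_pathSpace (B : OrderedBratteliDiagram) :
    T2Space B.PathSpace := by
  let _ : ∀ i, TopologicalSpace (B.E i) := fun _ => ⊥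
  have hdisc : ∀ i, DiscreteTopology (B.E i) := fun _ => ⟨rfl⟩
  exact Topology.IsEmbedding.t2Space (f := fun ξ : B.PathSpace => (ξ.1 : ∀ i, B.E i))
    ⟨⟨rfl⟩, Subtype.val_injective⟩

open OpenPartialHomeomorph in
theorem theorem3p9 {X : Type*} [TopologicalSpace X] (hX : Nonempty (X ≃ₜ cantorSet))
    (h : OpenPartialHomeomorph X X)
    (hU_finite : h.sourceᶜ.Finite) (hU_nonempty : h.sourceᶜ.Nonempty)
    (hV_finite : h.targetᶜ.Finite) (hV_nonempty : h.targetᶜ.Nonempty)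
    (hUV : Disjoint h.sourceᶜ h.targetᶜ) (hmin : h.IsMinimal)
    (S : KRSequence h) :
    ∃ φ : X ≃ S.toDiagram.PathSpace,
      PartialAction.IsIsomorphism h.toPartialAction S.toDiagram.vershik.toPartialAction φ ∧
      φ '' h.sourceᶜ = S.toDiagram.maxPaths ∧ φ '' h.targetᶜ = S.toDiagram.minPaths := by
  obtain ⟨c⟩ := hX
  have : CompactSpace cantorSet := isCompact_iff_compactSpace.1 isCompact_cantorSet
  have : CompactSpace X := c.symm.compactSpace
  have : T2Space X := c.symm.t2Space
  have := S.toDiagram.t2Space_pathSpace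
  let φ : X ≃ S.toDiagram.PathSpace :=
    Equiv.ofBijective S.path ⟨S.injective_path, S.surjective_path⟩
  have hφ : Continuous φ := S.continuous_path
  have hsymm : Continuous φ.symm := (hφ.homeoOfEquivCompactToT2).symm.continuous
  have hconj : ∀ x ∈ h.source, φ x ∈ S.toDiagram.vershik.source ∧
      S.toDiagram.vershik (φ x) = φ (h x) := by
    intro x hx
    have himg := S.isVershikImage_path hx
    exact ⟨himg.notMem_maxPaths,
      (S.toDiagram.isVershikImage_vershikFun himg.notMem_maxPaths).unique himg⟩
  have hmax : ∀ x, φ x ∈ S.toDiagram.maxPaths ↔ x ∉ h.source := S.path_mem_maxPaths_iff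
  -- Because maximal paths correspond exactly to `X_U`, the conjugacy reverses and the inverse is
  -- also a morphism.
  have hconj' : ∀ ξ ∈ S.toDiagram.vershik.source, φ.symm ξ ∈ h.source ∧
      h (φ.symm ξ) = φ.symm (S.toDiagram.vershik ξ) := by
    intro ξ hξ
    obtain ⟨x, rfl⟩ := φ.surjective ξ
    have hx : x ∈ h.source := not_not.1 fun hx => hξ ((hmax x).2 hx)
    rw [φ.symm_apply_apply, (hconj x hx).2, φ.symm_apply_apply]
    exact ⟨hx, rfl⟩
  refine ⟨φ, ⟨PartialAction.toPartialAction_isMorphism hφ (zPowRel_of_semiconj hconj),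
    PartialAction.toPartialAction_isMorphism hsymm (zPowRel_of_semiconj hconj')⟩, ?_, ?_⟩
  · ext ξ
    obtain ⟨x, rfl⟩ := φ.surjective ξ
    rw [φ.injective.mem_set_image]
    exact (S.path_mem_maxPaths_iff x).symm
  · ext ξ
    obtain ⟨x, rfl⟩ := φ.surjective ξ
    rw [φ.injective.mem_set_image]
    exact (S.path_mem_minPaths_iff x).symm
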